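/- **Power system model.** Let $M,T'_{do},T_A,D,E_1,E_2$ be real diagonal $n\times n$ matrices, with $M$, $T'_{do}$, $T_A$ positive definite, let $L_1,L_2,L_3\in\mathbb R^{n\times n}$ have zero row sums, and let $F_1,F_2,F_3\in\mathbb R^{n\times n}$. Put $$A=\begin{bmatrix}0&I&0&0\\ M^{-1/2}L_1M^{-1/2}&-M^{-1/2}DM^{-1/2}&M^{-1/2}F_1M^{-1/2}&0\\ M^{1/2}T_{do}'^{-1}L_2M^{-1/2}&0&M^{1/2}T_{do}'^{-1}F_2M^{-1/2}&E_1\\ M^{1/2}T_A^{-1}L_3M^{-1/2}&0&M^{1/2}T_A^{-1}F_3M^{-1/2}&-E_2\end{bmatrix},\qquad B=\begin{bmatrix}0\\0\\0\\M^{1/2}T_A^{-1}\end{bmatrix}$$ (in the normalized model $E_1=E_2=I$). Let $v_0=[\bar v^T\ 0\ 0\ 0]^T$ with $\bar v=M^{1/2}\mathbf 1_n/\sqrt{\mathrm{tr}\,M}$, so that $Av_0=0$. Assume that $0$ is a simple eigenvalue of $A$ and that all other eigenvalues of $A$ have negative real part. Let $w_0$ be the left null vector, $w_0^TA=0$, $w_0^Tv_0=1$,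 let $\epsilon>0$, and put $A_\epsilon=A-\epsilon v_0w_0^T$. Let $Q\succeq0$ have kernel exactly $\mathrm{span}(v_0)$, let $R\succ0$, put $G=BR^{-1}B^T$, and let $X_\epsilon\succeq0$ be the stabilizing solution of $A_\epsilon^TX+XA_\epsilon+Q-XGX=0$, i.e. the one for which $A_\epsilon-GX_\epsilon$ is Hurwitz. Let $B_d\in\mathbb R^{4n\times n_d}$ have columns of unit Euclidean norm, let $\bar\omega>0$, and let $$\Phi=\frac1{2\pi}\int_{-\bar\omega}^{\bar\omega}(\mathrm i\omega I-A_\epsilon+GX_\epsilon)^{-1}B_dB_d^T(-\mathrm i\omega I-A_\epsilon^T+X_\epsilon G)^{-1}\,d\omega .$$ **Low-rank approximation.** Suppose that the Hamiltonian matrix $H=\begin{bmatrix}A_\epsilon&-G\\-Q&-A_\epsilon^T\end{bmatrix}$ has $4n$ linearly independent eigenvectors for eigenvalues in the open left half plane. Let them be the columns of $\begin{bmatrix}Z\\\bar Z\end{bmatrix}$ with $Z,\bar Z\in\mathbb C^{4n\times4n}$, in any order, so that $H\begin{bmatrix}Z\\\bar Z\end{bmatrix}=\begin{bmatrix}Z\\\bar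 Z\end{bmatrix}\mathrm{diag}(\lambda_1,\dots,\lambda_{4n})$, and write $\lambda_i=a_i+\mathrm ib_i$ with $a_i<0$. ($Z$ is then invertible.) Put $$\theta_{ci}=\arctan\frac{b_i-\bar\omega}{a_i}-\arctan\frac{b_i+\bar\omega}{a_i},\qquad c_i=\frac1{2\pi}\Big[\theta_{ci}-\frac{\mathrm i}2\ln\frac{a_i^2+(b_i-\bar\omega)^2}{a_i^2+(b_i+\bar\omega)^2}\Big],$$ $$\mathcal C_{ij}=-\frac{[Z^{-1}]_{i,:}B_dB_d^*[Z^{-*}]_{:,j}}{\lambda_i+\lambda_j^*}\,(c_i+c_j^*),\qquad \Phi_\kappa=[Z]_{:,1:\kappa}\,[\mathcal C]_{1:\kappa,1:\kappa}\,[Z^*]_{1:\kappa,:}\qquad(0\le\kappa\le4n).$$ **Projections.** Let $w\in\mathbb R^n$ be a weight vector (for instance $w=\bar v$) and $r$ a number of clusters. For a partition of $\{1,\dots,n\}$ into non-empty sets $\mathcal I_1,\dots,\mathcal I_r$ such that each restriction $w_{\mathcal I_i}$ is nonzero, let $P\in\mathbb R^{r\times n}$ be given by $P_{ij}=w_j/\|w_{\mathcal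 I_i}\|_2$ if $j\in\mathcal I_i$ and $P_{ij}=0$ otherwise, and put $\Pi=I_4\otimes P$. **Theorem.** The matrices $\Phi$ and $\Phi_\kappa$ are Hermitian positive semidefinite. Let $\Phi^{1/2}$ and $\Phi_\kappa^{1/2}$ be any complex matrices with $4n$ rows such that $\Phi^{1/2}(\Phi^{1/2})^*=\Phi$ and $\Phi_\kappa^{1/2}(\Phi_\kappa^{1/2})^*=\Phi_\kappa$. Let $\Pi_*$ minimize $\xi_\kappa(\Pi)=\|(I-\Pi^T\Pi)\Phi_\kappa^{1/2}\|_F$ over all these projections $\Pi$, and let $\xi_{\kappa*}=\xi_\kappa(\Pi_*)$ be the optimum. Then $$\|(I-\Pi_*^T\Pi_*)\Phi^{1/2}\|_F-\xi_{\kappa*}\ \le\ \sqrt{\eta^2\,n_d\sum_{i=\kappa+1}^{4n}-\frac{\theta_{ci}}{2\pi a_i}},$$ where $\eta=\|Z^{-1}\|_2\,\|Z\|_2$ is the condition number of $Z^{-1}$ in the spectral norm. -/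

import Mathlib

open scoped Kronecker Matrix ComplexOrder

namespace WAC

noncomputable section

/-- The data of the linearized flux-decay model of a power system with `n` generators: inertias `M`,
direct-axis time constants `Tdo`, regulator time constants `TA`, dampings `D`, the asymmetric
Laplacians `L₁, L₂, L₃` (zero row sums), and the matrices `F₁, F₂, F₃`.
`kE` and `kF` are the diagonals of the blocks through which the field voltages enter the last two
state equations: both are `1` in the normalized model, and they are `1 / Tdo` and `1 / TA` if the
time constants are kept there. -/
structure PowerSystem (n : ℕ) where
  M : Fin n → ℝ
  Tdo : Fin n → ℝ
  TA : Fin n → ℝ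
  D : Fin n → ℝ
  kE : Fin n → ℝ
  kF : Fin n → ℝ
  L₁ : Matrix (Fin n) (Fin n) ℝ
  L₂ : Matrix (Fin n) (Fin n) ℝ
  L₃ : Matrix (Fin n) (Fin n) ℝ
  F₁ : Matrix (Fin n) (Fin n) ℝ
  F₂ : Matrix (Fin n) (Fin n) ℝ
  F₃ : Matrix (Fin n) (Fin n) ℝ
  M_pos : ∀ i, 0 < M i
  Tdo_pos : ∀ i, 0 < Tdo i
  TA_pos : ∀ i, 0 < TA i
  L₁_row : ∀ i, ∑ j, L₁ i j = 0
  L₂_row : ∀ i, ∑ j, L₂ i j = 0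
  L₃_row : ∀ i, ∑ j, L₃ i j = 0

namespace PowerSystem

variable {n : ℕ} (S : PowerSystem n)

/-- `M^{1/2}`. -/
def sqrtM : Matrix (Fin n) (Fin n) ℝ := Matrix.diagonal fun i => √(S.M i)

/-- `M^{-1/2}`. -/
def invSqrtM : Matrix (Fin n) (Fin n) ℝ := Matrix.diagonal fun i => (√(S.M i))⁻¹

/-- The inverse of the diagonal matrix of the direct-axis time constants. -/
def invTdo : Matrix (Fin n) (Fin n) ℝ := Matrix.diagonal fun i => (S.Tdo i)⁻¹

/-- The inverse of the diagonal matrix of the regulator time constants. -/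
def invTA : Matrix (Fin n) (Fin n) ℝ := Matrix.diagonal fun i => (S.TA i)⁻¹

/-- The state matrix, with the state stacked as `(x₁, x₂, x₃, x₄)` (angles, frequencies, internal
voltages, field voltages, each scaled by `M^{1/2}`). -/
def stateMatrix : Matrix (Fin (4 * n)) (Fin (4 * n)) ℝ :=
  Matrix.reindex finProdFinEquiv finProdFinEquiv <|
    Matrix.comp (Fin 4) (Fin 4) (Fin n) (Fin n) ℝ
      !![0, 1, 0, 0;
         S.invSqrtM * S.L₁ * S.invSqrtM,
           -(S.invSqrtM * Matrix.diagonal S.D * S.invSqrtM),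
           S.invSqrtM * S.F₁ * S.invSqrtM, 0;
         S.sqrtM * S.invTdo * S.L₂ * S.invSqrtM, 0,
           S.sqrtM * S.invTdo * S.F₂ * S.invSqrtM, Matrix.diagonal S.kE;
         S.sqrtM * S.invTA * S.L₃ * S.invSqrtM, 0,
           S.sqrtM * S.invTA * S.F₃ * S.invSqrtM, -Matrix.diagonal S.kF]

/-- The input matrix `B`, whose only nonzero block is the last one, `B₁ = M^{1/2} T_A⁻¹`. -/
def inputMatrix : Matrix (Fin (4 * n)) (Fin n) ℝ :=
  Matrix.of fun i j =>
    if (finProdFinEquiv.symm i).1 = 3 then (S.sqrtM * S.invTA) (finProdFinEquiv.symm i).2 j else 0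

/-- `v̄ = M^{1/2} 1 / √(tr M)`. -/
def vbar (j : Fin n) : ℝ := √(S.M j) / √(∑ i, S.M i)

/-- The consensus vector `v₀ = (v̄, 0, 0, 0)`. -/
def v0 (i : Fin (4 * n)) : ℝ :=
  if (finProdFinEquiv.symm i).1 = 0 then S.vbar (finProdFinEquiv.symm i).2 else 0

end PowerSystem

/-- A real matrix viewed as a complex one. -/
abbrev toC {m p : Type*} (A : Matrix m p ℝ) : Matrix m p ℂ := A.map Complex.ofReal

/-- All eigenvalues lie in the open left half plane. -/
def IsHurwitz {N : ℕ} (A : Matrix (Fin N) (Fin N) ℝ) : Prop :=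
  ∀ μ ∈ spectrum ℂ (toC A), μ.re < 0

/-- All eigenvalues lie in the open left half plane, except for one (simple) zero eigenvalue. -/
def IsConsensusStable {N : ℕ} (A : Matrix (Fin N) (Fin N) ℝ) : Prop :=
  (toC A).charpoly.rootMultiplicity 0 = 1 ∧ ∀ μ ∈ spectrum ℂ (toC A), μ ≠ 0 → μ.re < 0

/-- `A_ε = A - ε v₀ w₀ᵀ`. -/
def shifted {N : ℕ} (A : Matrix (Fin N) (Fin N) ℝ) (v₀ w₀ : Fin N → ℝ) (ε : ℝ) :
    Matrix (Fin N) (Fin N) ℝ :=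
  A - ε • Matrix.vecMulVec v₀ w₀

/-- `G = B R⁻¹ Bᵀ`. -/
def gainMatrix {N m : ℕ} (B : Matrix (Fin N) (Fin m) ℝ) (R : Matrix (Fin m) (Fin m) ℝ) :
    Matrix (Fin N) (Fin N) ℝ :=
  B * R⁻¹ * Bᵀ

/-- `X` is the stabilizing solution of the Riccati equation `AᵀX + XA + Q - XGX = 0`. -/
structure IsStabilizingSolution {N : ℕ} (A G Q X : Matrix (Fin N) (Fin N) ℝ) : Prop where
  posSemidef : X.PosSemidef
  riccati : Aᵀ * X + X * A + Q - X * G * X = 0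
  hurwitz : IsHurwitz (A - G * X)

/-- The Hamiltonian matrix of the Riccati equation. -/
def hamiltonian {N : ℕ} (A G Q : Matrix (Fin N) (Fin N) ℝ) :
    Matrix (Fin N ⊕ Fin N) (Fin N ⊕ Fin N) ℝ :=
  Matrix.fromBlocks A (-G) (-Q) (-Aᵀ)

/-- The columns of `[Z; Zb]` are `N` linearly independent eigenvectors of the `2N × 2N` Hamiltonian
matrix, with eigenvalues `lam 0, …, lam (N - 1)` in the open left half plane. (A Hamiltonian matrix
has at most `N` such eigenvalues, so these are all of them, and the columns are a basis of the
stable invariant subspace.) -/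
structure IsStableEigenbasis {N : ℕ} (H : Matrix (Fin N ⊕ Fin N) (Fin N ⊕ Fin N) ℝ)
    (Z Zb : Matrix (Fin N) (Fin N) ℂ) (lam : Fin N → ℂ) : Prop where
  eigen : toC H * Matrix.fromRows Z Zb = Matrix.fromRows Z Zb * Matrix.diagonal lam
  stable : ∀ i, (lam i).re < 0
  independent : LinearIndependent ℂ (Matrix.fromRows Z Zb).col

/-- The band-limited Gramian
`Φ = (1/2π) ∫_{-ω̄}^{ω̄} (iω - A + GX)⁻¹ B_d B_dᵀ (-iω - Aᵀ + XG)⁻¹ dω`. -/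
def gramian {N nd : ℕ} (A G X : Matrix (Fin N) (Fin N) ℝ) (Bd : Matrix (Fin N) (Fin nd) ℝ)
    (ω' : ℝ) : Matrix (Fin N) (Fin N) ℂ :=
  Matrix.of fun i j => (1 / (2 * (Real.pi : ℂ))) * ∫ ω in (-ω')..ω',
    (((Complex.I * ω) • (1 : Matrix (Fin N) (Fin N) ℂ) - toC A + toC G * toC X)⁻¹
      * (toC Bd * (toC Bd)ᵀ)
      * ((-(Complex.I * ω)) • (1 : Matrix (Fin N) (Fin N) ℂ) - (toC A)ᵀ + toC X * toC G)⁻¹) i j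

/-- `θ_c = arctan((b - ω̄)/a) - arctan((b + ω̄)/a)` for the eigenvalue `μ = a + ib`. -/
def thetaC (ω' : ℝ) (μ : ℂ) : ℝ :=
  Real.arctan ((μ.im - ω') / μ.re) - Real.arctan ((μ.im + ω') / μ.re)

/-- `c = (1/2π) (θ_c - (i/2) ln((a² + (b - ω̄)²)/(a² + (b + ω̄)²)))` for the eigenvalue
`μ = a + ib`. -/
def cauchyCoeff (ω' : ℝ) (μ : ℂ) : ℂ :=
  (1 / (2 * (Real.pi : ℂ))) * ((thetaC ω' μ : ℂ) - (Complex.I / 2) *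
    (Real.log ((μ.re ^ 2 + (μ.im - ω') ^ 2) / (μ.re ^ 2 + (μ.im + ω') ^ 2)) : ℂ))

/-- The Cauchy-like matrix
`𝒞_ij = - [Z⁻¹]_{i,:} B_d B_d^* [Z^{-*}]_{:,j} (c_i + c_j^*) / (λ_i + λ_j^*)`. -/
def cauchyLike {N nd : ℕ} (Z : Matrix (Fin N) (Fin N) ℂ) (lam : Fin N → ℂ)
    (Bd : Matrix (Fin N) (Fin nd) ℝ) (ω' : ℝ) : Matrix (Fin N) (Fin N) ℂ :=
  Matrix.of fun i j =>
    -((Z⁻¹ * (toC Bd * (toC Bd)ᴴ) * (Z⁻¹)ᴴ) i j / (lam i + star (lam j)))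
      * (cauchyCoeff ω' (lam i) + star (cauchyCoeff ω' (lam j)))

/-- `Φ_κ = [Z]_{:,1:κ} [𝒞]_{1:κ,1:κ} [Z^*]_{1:κ,:}`. -/
def lowRankGramian {N nd : ℕ} (Z : Matrix (Fin N) (Fin N) ℂ) (lam : Fin N → ℂ)
    (Bd : Matrix (Fin N) (Fin nd) ℝ) (ω' : ℝ) (κ : ℕ) (hκ : κ ≤ N) :
    Matrix (Fin N) (Fin N) ℂ :=
  Z.submatrix id (Fin.castLE hκ)
    * (cauchyLike Z lam Bd ω').submatrix (Fin.castLE hκ) (Fin.castLE hκ)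
    * Zᴴ.submatrix (Fin.castLE hκ) id

/-- The clusterings of `n` generators into `r` clusters that are admissible for the weight `w`, given
by the map sending a generator to its cluster: every cluster is non-empty, and `w` restricted to it
is not the zero vector. -/
def admissible {n : ℕ} (r : ℕ) (w : Fin n → ℝ) : Set (Fin n → Fin r) :=
  {c | ∀ i, ∃ j, c j = i ∧ w j ≠ 0}

/-- The clustering-based projection `P`: `P_ij = w_j / ‖w_{𝓘_i}‖₂` for `j ∈ 𝓘_i`, and `0`
otherwise. -/
def clusterProj {n r : ℕ} (w : Fin n → ℝ) (c : Fin n → Fin r) : Matrix (Fin r) (Fin n) ℝ :=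
  Matrix.of fun i j => if c j = i then w j / √(∑ k with c k = i, w k ^ 2) else 0

/-- The stacked projection `Π = I₄ ⊗ P`. -/
def stackedProj {n r : ℕ} (w : Fin n → ℝ) (c : Fin n → Fin r) :
    Matrix (Fin (4 * r)) (Fin (4 * n)) ℝ :=
  Matrix.reindex finProdFinEquiv finProdFinEquiv
    ((1 : Matrix (Fin 4) (Fin 4) ℝ) ⊗ₖ clusterProj w c)

/-- The Frobenius norm. -/
def frobNorm {m p : ℕ} (A : Matrix (Fin m) (Fin p) ℂ) : ℝ := √(∑ i, ∑ j, ‖A i j‖ ^ 2)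

/-- The spectral norm (largest singular value). -/
def specNorm {N : ℕ} (A : Matrix (Fin N) (Fin N) ℂ) : ℝ :=
  ‖Matrix.toEuclideanCLM (𝕜 := ℂ) (n := Fin N) A‖

/-- The condition number of an invertible matrix, for the spectral norm. -/
def condNumber {N : ℕ} (A : Matrix (Fin N) (Fin N) ℂ) : ℝ := specNorm A * specNorm A⁻¹

/-- `‖(I - ΠᵀΠ) T‖_F`, the objective of both optimization problems: `T = Φ^{1/2}` in one and
`T = Φ_κ^{1/2}` in the other. -/
def objective {n r p : ℕ} (w : Fin n → ℝ) (T : Matrix (Fin (4 * n)) (Fin p) ℂ)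
    (c : Fin n → Fin r) : ℝ :=
  frobNorm ((1 - toC ((stackedProj w c)ᵀ * stackedProj w c)) * T)

end

end WAC

namespace WAC

open Matrix Complex

/-! The stable eigenvectors of the Hamiltonian matrix diagonalize the closed loop: `Zb = X Z`, hence
`(A - G X) Z = Z Λ`. In these coordinates the resolvent is diagonal, the frequency integral can be
evaluated entry by entry, and `Φ = Z 𝒞 Zᴴ` (`gramian_eq`). Being an integral of congruences of a
positive semidefinite matrix, `𝒞` is positive semidefinite and factors as `T Tᴴ`.

Keeping the leading block of `𝒞` amounts to zeroing the last rows of `T`, so `Φ_κ = (Z T')(Z T')ᴴ`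
with `T'` the truncation. The Frobenius norm of `E U` depends only on `U Uᴴ`, so the given square
roots may be replaced by `Z T` and `Z T'`. With `E` an orthogonal projection, the triangle
inequality bounds the gap by `‖Z‖ ‖T - T'‖_F`. The square of the last factor is the sum of the
trailing diagonal entries of `𝒞`, and each of these is at most `‖Z⁻¹‖² n_d` times `-θ / (2π a)`. -/

lemma toC_mul {l m p : Type*} [Fintype m] (A : Matrix l m ℝ) (B : Matrix m p ℝ) :
    toC (A * B) = toC A * toC B :=
  Matrix.map_mul (f := Complex.ofRealHom)

/-! ### Norms -/

lemma frobNorm_sq {m p : ℕ} (T : Matrix (Fin m) (Fin p) ℂ) :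
    frobNorm T ^ 2 = ∑ i, ∑ j, ‖T i j‖ ^ 2 :=
  Real.sq_sqrt (by positivity)

lemma frobNorm_nonneg {m p : ℕ} (T : Matrix (Fin m) (Fin p) ℂ) : 0 ≤ frobNorm T :=
  Real.sqrt_nonneg _

lemma mul_conjTranspose_apply_self {m p : Type*} [Fintype p] (T : Matrix m p ℂ) (i : m) :
    (T * Tᴴ) i i = ((∑ j, ‖T i j‖ ^ 2 : ℝ) : ℂ) := by
  simp [mul_apply, mul_conj, normSq_eq_norm_sq]

/-- The squared norm is the trace of `S Sᴴ`. This makes the choice of square root immaterial. -/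
lemma frobNorm_eq_of_mul_conjTranspose_eq {m p q : ℕ} {S : Matrix (Fin m) (Fin p) ℂ}
    {T : Matrix (Fin m) (Fin q) ℂ} (h : S * Sᴴ = T * Tᴴ) : frobNorm S = frobNorm T := by
  unfold frobNorm
  congr 1
  refine Finset.sum_congr rfl fun i _ => ?_
  have := congrFun (congrFun h i) i
  rw [mul_conjTranspose_apply_self, mul_conjTranspose_apply_self] at this
  exact_mod_cast this

lemma frobNorm_add_le {m p : ℕ} (S T : Matrix (Fin m) (Fin p) ℂ) :
    frobNorm (S + T) ≤ frobNorm S + frobNorm T := by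
  have key : ∀ U : Matrix (Fin m) (Fin p) ℂ,
      frobNorm U = ‖WithLp.toLp 2 (fun x : Fin m × Fin p => U x.1 x.2)‖ := fun U => by
    rw [EuclideanSpace.norm_eq, frobNorm, Fintype.sum_prod_type]
  simp only [key]
  exact norm_add_le (WithLp.toLp 2 fun x : Fin m × Fin p => S x.1 x.2)
    (WithLp.toLp 2 fun x : Fin m × Fin p => T x.1 x.2)

lemma specNorm_nonneg {N : ℕ} (A : Matrix (Fin N) (Fin N) ℂ) : 0 ≤ specNorm A := norm_nonneg _

lemma sum_norm_sq_mulVec_le {N : ℕ} (A : Matrix (Fin N) (Fin N) ℂ) (x : Fin N → ℂ) :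
    ∑ i, ‖(A *ᵥ x) i‖ ^ 2 ≤ specNorm A ^ 2 * ∑ i, ‖x i‖ ^ 2 := by
  have h := (toEuclideanCLM (𝕜 := ℂ) (n := Fin N) A).le_opNorm (WithLp.toLp 2 x)
  have h2 := pow_le_pow_left₀ (norm_nonneg _) h 2
  rw [mul_pow, EuclideanSpace.norm_sq_eq, EuclideanSpace.norm_sq_eq, toEuclideanCLM_toLp] at h2
  exact h2

lemma frobNorm_mul_le {N p : ℕ} (A : Matrix (Fin N) (Fin N) ℂ) (T : Matrix (Fin N) (Fin p) ℂ) :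
    frobNorm (A * T) ≤ specNorm A * frobNorm T := by
  refine abs_le_of_sq_le_sq' ?_ (mul_nonneg (specNorm_nonneg A) (frobNorm_nonneg T)) |>.2
  -- Summing over columns on the outside reduces the claim to the operator-norm bound for each
  -- column.
  rw [mul_pow, frobNorm_sq, frobNorm_sq, Finset.sum_comm,
    Finset.sum_comm (f := fun i j => ‖T i j‖ ^ 2), Finset.mul_sum]
  exact Finset.sum_le_sum fun j _ => sum_norm_sq_mulVec_le A fun i => T i j

lemma specNorm_le_one {N : ℕ} {E : Matrix (Fin N) (Fin N) ℂ} (hE : Eᴴ = E) (hEE : E * E = E) :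
    specNorm E ≤ 1 := by
  refine IsStarProjection.norm_le _ ⟨?_, ?_⟩
  · rw [IsIdempotentElem, ← map_mul, hEE]
  · rw [IsSelfAdjoint, ← map_star, star_eq_conjTranspose, hE]

/-! ### The clustering projections -/

/-- The rows have disjoint supports, and admissibility keeps the normalizing denominators nonzero.
-/
lemma clusterProj_mul_transpose {n r : ℕ} {w : Fin n → ℝ} {c : Fin n → Fin r}
    (hc : c ∈ admissible r w) : clusterProj w c * (clusterProj w c)ᵀ = 1 := by
  ext i i'
  rw [mul_apply]
  rcases eq_or_ne i i' with rfl | hi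
  · obtain ⟨j, hj, hwj⟩ := hc i
    have hs : 0 < ∑ k with c k = i, w k ^ 2 :=
      Finset.sum_pos' (fun k _ => sq_nonneg _) ⟨j, by simpa using hj, by positivity⟩
    have : ∀ k, clusterProj w c i k * (clusterProj w c)ᵀ k i =
        if c k = i then w k ^ 2 / ∑ k with c k = i, w k ^ 2 else 0 := fun k => by
      simp only [clusterProj, of_apply, transpose_apply]
      split_ifs
      · rw [div_mul_div_comm, Real.mul_self_sqrt hs.le, sq]
      · simp
    rw [one_apply_eq, Finset.sum_congr rfl fun k _ => this k, ← Finset.sum_filter,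
      ← Finset.sum_div, div_self hs.ne']
  · rw [one_apply_ne hi]
    refine Finset.sum_eq_zero fun k _ => ?_
    simp only [clusterProj, of_apply, transpose_apply]
    by_cases h : c k = i
    · have : c k ≠ i' := fun h' => hi (h.symm.trans h')
      simp [this]
    · simp [h]

lemma stackedProj_mul_transpose {n r : ℕ} {w : Fin n → ℝ} {c : Fin n → Fin r}
    (hc : c ∈ admissible r w) : stackedProj w c * (stackedProj w c)ᵀ = 1 := by
  simp only [stackedProj, reindex_apply, transpose_submatrix]
  rw [submatrix_mul_equiv, ← kroneckerMap_transpose, ← mul_kronecker_mul,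
    clusterProj_mul_transpose hc]
  simp

lemma specNorm_complement_le_one {n r : ℕ} {w : Fin n → ℝ} {c : Fin n → Fin r}
    (hc : c ∈ admissible r w) :
    specNorm (1 - toC ((stackedProj w c)ᵀ * stackedProj w c)) ≤ 1 := by
  set Y := (stackedProj w c)ᵀ * stackedProj w c with hY
  have hYt : Yᵀ = Y := by simp [hY]
  have hYY : Y * Y = Y := by
    rw [hY, Matrix.mul_assoc, ← Matrix.mul_assoc (stackedProj w c), stackedProj_mul_transpose hc,
      Matrix.one_mul]
  have hCC : toC Y * toC Y = toC Y := by
    rw [← toC_mul, hYY]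
  refine specNorm_le_one ?_ ?_
  · have : (toC Y)ᴴ = toC Y := by
      ext i j
      have := congrFun (congrFun hYt i) j
      simp only [transpose_apply] at this
      simp [this]
    rw [conjTranspose_sub, conjTranspose_one, this]
  · simp [Matrix.sub_mul, Matrix.mul_sub, hCC]

/-! ### The Riccati equation and the stable eigenvectors of the Hamiltonian matrix -/

/-- A Sylvester equation with disjoint spectra: a nonzero column `j` of `Y` would be an eigenvector
of `Aᵀ` for `-lam j`, which lies in the open right half plane. -/
lemma eq_zero_of_isHurwitz {N : ℕ} {A : Matrix (Fin N) (Fin N) ℝ} (hA : IsHurwitz A)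
    {Y : Matrix (Fin N) (Fin N) ℂ} {lam : Fin N → ℂ} (hlam : ∀ i, (lam i).re < 0)
    (h : Y * diagonal lam = -((toC A)ᵀ * Y)) : Y = 0 := by
  ext i j
  have hμ : -lam j ∉ spectrum ℂ (toC A) := fun hmem => by
    have := hA _ hmem
    rw [neg_re] at this
    linarith [hlam j]
  rw [spectrum.notMem_iff] at hμ
  have hu := (isUnit_transpose (A := _)).mpr hμ
  have h0 : (algebraMap ℂ (Matrix (Fin N) (Fin N) ℂ) (-lam j) - toC A)ᵀ *ᵥ (Y.col j) = 0 := by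
    ext k
    have := congrFun (congrFun h k) j
    rw [mul_diagonal] at this
    rw [transpose_sub, sub_mulVec, algebraMap_eq_diagonal, diagonal_transpose]
    simp only [Pi.sub_apply, mulVec_diagonal, col_apply, Pi.algebraMap_apply, Algebra.algebraMap_self,
      RingHom.id_apply, Pi.zero_apply]
    have h2 : ((toC A)ᵀ *ᵥ Y.col j) k = ((toC A)ᵀ * Y) k j := rfl
    rw [h2]
    rw [Matrix.neg_apply] at this
    linear_combination -this
  have := mulVec_injective_of_isUnit hu (h0.trans (mulVec_zero _).symm)
  exact congrFun this i

lemma transpose_gainMatrix {N m : ℕ} (B : Matrix (Fin N) (Fin m) ℝ)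
    {R : Matrix (Fin m) (Fin m) ℝ} (hR : Rᵀ = R) : (gainMatrix B R)ᵀ = gainMatrix B R := by
  simp [gainMatrix, transpose_mul, transpose_nonsing_inv, hR, Matrix.mul_assoc]

/-- The stable eigenvectors of the Hamiltonian matrix diagonalize the closed-loop matrix. -/
lemma IsStableEigenbasis.diagonalizes {N : ℕ} {A G Q X : Matrix (Fin N) (Fin N) ℝ}
    {Z Zb : Matrix (Fin N) (Fin N) ℂ} {lam : Fin N → ℂ} (hX : IsStabilizingSolution A G Q X)
    (hG : Gᵀ = G) (hZ : IsStableEigenbasis (hamiltonian A G Q) Z Zb lam) :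
    IsUnit Z ∧ toC (A - G * X) * Z = Z * diagonal lam := by
  have hXt : Xᵀ = X := hX.posSemidef.1
  have hH : toC (hamiltonian A G Q) =
      fromBlocks (toC A) (-toC G) (-toC Q) (-(toC A)ᵀ) := by
    rw [hamiltonian, toC, fromBlocks_map]
    congr 1 <;> ext <;> simp
  have e := hZ.eigen
  rw [hH, fromBlocks_mul_fromRows, fromRows_mul] at e
  obtain ⟨e1, e2⟩ := fromRows_inj e
  have hric : (toC A)ᵀ * toC X + toC X * toC A + toC Q - toC X * toC G * toC X = 0 := by
    have := congrArg toC hX.riccati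
    have hs : ∀ U V : Matrix (Fin N) (Fin N) ℝ, toC (U + V) = toC U + toC V := fun U V => by
      ext; simp
    have hd : ∀ U V : Matrix (Fin N) (Fin N) ℝ, toC (U - V) = toC U - toC V := fun U V => by
      ext; simp
    rw [hd, hs, hs, toC_mul, toC_mul, toC_mul, toC_mul] at this
    rw [show (toC A)ᵀ = toC Aᵀ from rfl, this]
    ext; simp
  have hcl : toC (A - G * X) = toC A - toC G * toC X := by
    rw [← toC_mul]; ext; simp
  have hclt : (toC (A - G * X))ᵀ = (toC A)ᵀ - toC X * toC G := by
    rw [hcl, transpose_sub, transpose_mul, show (toC X)ᵀ = toC Xᵀ from rfl,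
      show (toC G)ᵀ = toC Gᵀ from rfl, hXt, hG]
  have hY : Zb - toC X * Z = 0 := by
    refine eq_zero_of_isHurwitz hX.hurwitz hZ.stable ?_
    rw [hclt, Matrix.sub_mul, Matrix.mul_assoc, ← e1, ← e2]
    -- The two sides of the Sylvester equation differ by minus the Riccati residual times `Z`.
    have : -(((toC A)ᵀ * toC X + toC X * toC A + toC Q - toC X * toC G * toC X) * Z) = 0 := by
      rw [hric]; simp
    rw [← sub_eq_zero, ← this]
    noncomm_ring
  have hZb : Zb = toC X * Z := sub_eq_zero.mp hY
  refine ⟨?_, ?_⟩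
  -- Since `Zb = X Z`, the stacked matrix is determined by `Z`, so its injectivity passes to `Z`.
  · rw [← linearIndependent_cols_iff_isUnit, ← mulVec_injective_iff]
    have hind := mulVec_injective_iff.mpr hZ.independent
    intro x y hxy
    apply hind
    rw [fromRows_mulVec, fromRows_mulVec, hZb, ← mulVec_mulVec, ← mulVec_mulVec, hxy]
  · rw [hcl, ← e1, hZb]
    noncomm_ring

/-! ### The scalar integrals -/

lemma I_mul_sub_ne_zero {μ : ℂ} (hμ : μ.re < 0) (ω : ℝ) : I * ω - μ ≠ 0 := fun h => by
  have := congrArg re h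
  simp at this
  exact hμ.ne this

lemma continuous_inv_I_mul_sub {μ : ℂ} (hμ : μ.re < 0) :
    Continuous fun ω : ℝ => (I * ω - μ)⁻¹ :=
  Continuous.inv₀ (by fun_prop) (I_mul_sub_ne_zero hμ)

lemma integral_inv_I_mul_sub {μ : ℂ} (hμ : μ.re < 0) (b : ℝ) :
    ∫ ω in (-b)..b, (I * (ω : ℂ) - μ)⁻¹ = 2 * Real.pi * cauchyCoeff b μ := by
  have hpos : ∀ ω : ℝ, 0 < μ.re ^ 2 + (μ.im - ω) ^ 2 := fun ω => by nlinarith [sq_nonneg (μ.im - ω)]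
  -- The antiderivative is `-i log(iω - μ)`, split into argument and modulus. As `-μ.re > 0`, the
  -- argument is a single arctangent on the whole line.
  have hderiv : ∀ ω : ℝ, HasDerivAt (fun ω : ℝ => ((Real.arctan ((μ.im - ω) / μ.re) : ℝ) : ℂ) -
      I / 2 * ((Real.log (μ.re ^ 2 + (μ.im - ω) ^ 2) : ℝ) : ℂ)) ((I * (ω : ℂ) - μ)⁻¹) ω := by
    intro ω
    have h1 : HasDerivAt (fun ω : ℝ => μ.im - ω) (-1) ω := by
      simpa using (hasDerivAt_id ω).const_sub μ.im
    have h2 := (h1.div_const μ.re).arctan.ofReal_comp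
    have h3 := ((((h1.pow 2).const_add (μ.re ^ 2)).log (hpos ω).ne').ofReal_comp).const_mul (I / 2)
    refine (h2.sub h3).congr_deriv ?_
    have hne := I_mul_sub_ne_zero hμ ω
    have hre : (μ.re : ℂ) ≠ 0 := by exact_mod_cast hμ.ne
    have hp : ((μ.re : ℂ) ^ 2 + (μ.im - ω) ^ 2) ≠ 0 := by exact_mod_cast (hpos ω).ne'
    have hq : (1 + ((μ.im - ω : ℂ) / μ.re) ^ 2) ≠ 0 := by
      have : (1 + ((μ.im - ω : ℂ) / μ.re) ^ 2) = (μ.re ^ 2 + (μ.im - ω) ^ 2) / μ.re ^ 2 := by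
        field_simp
      rw [this]
      exact div_ne_zero hp (pow_ne_zero 2 hre)
    -- The second factor is the complex conjugate of the first.
    have hfac : (I * (ω : ℂ) - μ) * (-μ.re + I * (μ.im - ω)) = μ.re ^ 2 + (μ.im - ω) ^ 2 := by
      conv_lhs => rw [← re_add_im μ]
      simp only [add_re, ofReal_re, mul_re, I_re, mul_zero, ofReal_im, I_im, mul_one, sub_self,
        add_zero, add_im, mul_im, zero_add]
      linear_combination (-((μ.im : ℂ) - ω) ^ 2) * I_sq
    have hinv : (I * (ω : ℂ) - μ)⁻¹ =
        (-μ.re + I * (μ.im - ω)) / (μ.re ^ 2 + (μ.im - ω) ^ 2) := by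
      rw [← hfac]
      have h0 : (-μ.re + I * (μ.im - ω) : ℂ) ≠ 0 := fun h => hp (by rw [← hfac, h, mul_zero])
      field_simp
    rw [hinv]
    simp only [Pi.pow_apply]
    push_cast
    field_simp
    ring
  rw [intervalIntegral.integral_eq_sub_of_hasDerivAt (fun ω _ => hderiv ω)
    ((continuous_inv_I_mul_sub hμ).intervalIntegrable _ _), cauchyCoeff, thetaC,
    Real.log_div (hpos b).ne' (by simpa using (hpos (-b)).ne')]
  have : (Real.pi : ℂ) ≠ 0 := by exact_mod_cast Real.pi_ne_zero
  simp only [sub_neg_eq_add]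
  push_cast
  field_simp
  ring

lemma two_pi_mul_cauchyCoeff_re (b : ℝ) (μ : ℂ) :
    2 * Real.pi * (cauchyCoeff b μ).re = thetaC b μ := by
  have h : cauchyCoeff b μ = ((2 * Real.pi)⁻¹ : ℝ) * ((thetaC b μ : ℂ) - (I / 2) *
    (Real.log ((μ.re ^ 2 + (μ.im - b) ^ 2) / (μ.re ^ 2 + (μ.im + b) ^ 2)) : ℂ)) := by
    rw [cauchyCoeff]; push_cast; ring
  rw [h, re_ofReal_mul]
  have : (Real.pi : ℝ) ≠ 0 := Real.pi_ne_zero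
  simp
  field_simp

lemma thetaC_nonneg {b : ℝ} (hb : 0 ≤ b) {μ : ℂ} (hμ : μ.re < 0) : 0 ≤ thetaC b μ := by
  refine sub_nonneg.mpr (Real.arctan_mono ?_)
  exact div_le_div_of_nonpos_of_le hμ.le (by linarith)

lemma add_star_ne_zero {μ ν : ℂ} (hμ : μ.re < 0) (hν : ν.re < 0) : μ + star ν ≠ 0 := fun h => by
  have := congrArg re h
  simp at this
  linarith

lemma integral_inv_mul_star_inv {μ ν : ℂ} (hμ : μ.re < 0) (hν : ν.re < 0) (b : ℝ) :
    1 / (2 * (Real.pi : ℂ)) * ∫ ω in (-b)..b, (I * (ω : ℂ) - μ)⁻¹ * star (I * (ω : ℂ) - ν)⁻¹ =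
      -(cauchyCoeff b μ + star (cauchyCoeff b ν)) / (μ + star ν) := by
  have hs := add_star_ne_zero hμ hν
  -- Partial fractions: the two denominators add up to `-(μ + star ν)`, independently of `ω`.
  have hpf : ∀ ω : ℝ, (I * (ω : ℂ) - μ)⁻¹ * star (I * (ω : ℂ) - ν)⁻¹ =
      -(μ + star ν)⁻¹ * ((I * (ω : ℂ) - μ)⁻¹ + star (I * (ω : ℂ) - ν)⁻¹) := fun ω => by
    have h1 := I_mul_sub_ne_zero hμ ω
    have h2 : star (I * (ω : ℂ) - ν) ≠ 0 := star_ne_zero.mpr (I_mul_sub_ne_zero hν ω)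
    have h3 : star (I * (ω : ℂ) - ν) = -(I * ω) - star ν := by simp
    rw [star_inv₀, h3]
    rw [h3] at h2
    field_simp
    ring
  have hc1 := continuous_inv_I_mul_sub hμ
  have hc2 : Continuous fun ω : ℝ => star (I * (ω : ℂ) - ν)⁻¹ := (continuous_inv_I_mul_sub hν).star
  have hst : ∫ ω in (-b)..b, star (I * (ω : ℂ) - ν)⁻¹ = star (2 * Real.pi * cauchyCoeff b ν) := by
    rw [← integral_inv_I_mul_sub hν]
    exact intervalIntegral.intervalIntegral_conj ..
  simp only [hpf]
  rw [intervalIntegral.integral_const_mul, intervalIntegral.integral_add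
    (hc1.intervalIntegrable _ _) (hc2.intervalIntegrable _ _), hst, integral_inv_I_mul_sub hμ]
  have : (Real.pi : ℂ) ≠ 0 := by exact_mod_cast Real.pi_ne_zero
  have h4 : star (2 * (Real.pi : ℂ) * cauchyCoeff b ν) = 2 * Real.pi * star (cauchyCoeff b ν) := by
    simp
  rw [h4]
  field_simp

/-! ### The Cauchy-like matrix -/

/-- The quadratic form commutes with the integral, whose integrand is then nonnegative. -/
lemma posSemidef_integral {N : ℕ} {F : ℝ → Matrix (Fin N) (Fin N) ℂ} (hF : Continuous F)
    (hpos : ∀ t, (F t).PosSemidef) {a b : ℝ} (hab : a ≤ b) :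
    (Matrix.of fun i j => ∫ t in a..b, F t i j : Matrix (Fin N) (Fin N) ℂ).PosSemidef := by
  have hint : ∀ i j (z : ℂ), IntervalIntegrable (fun t => F t i j * z) MeasureTheory.volume a b :=
    fun i j z => Continuous.intervalIntegrable (by fun_prop) _ _
  refine PosSemidef.of_dotProduct_mulVec_nonneg ?_ fun x => ?_
  · ext i j
    rw [conjTranspose_apply, of_apply, of_apply]
    refine (intervalIntegral.intervalIntegral_conj ..).symm.trans ?_
    congr 1; ext t
    exact congrFun (congrFun (hpos t).1 i) j
  · have : star x ⬝ᵥ ((Matrix.of fun i j => ∫ t in a..b, F t i j) *ᵥ x) =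
        ∫ t in a..b, star x ⬝ᵥ (F t *ᵥ x) := by
      simp only [dotProduct, mulVec, of_apply]
      rw [intervalIntegral.integral_finsetSum fun i _ =>
        Continuous.intervalIntegrable (by fun_prop) _ _]
      refine Finset.sum_congr rfl fun i _ => ?_
      rw [intervalIntegral.integral_const_mul, intervalIntegral.integral_finsetSum
        fun j _ => hint i j _]
      simp
    rw [this, intervalIntegral.integral_of_le hab]
    exact MeasureTheory.integral_nonneg fun t => (hpos t).dotProduct_mulVec_nonneg x

/-- The inverse of `iω - Λ` for the diagonal matrix `Λ` of the eigenvalues. -/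
noncomputable def diagResolvent {N : ℕ} (lam : Fin N → ℂ) (ω : ℝ) : Matrix (Fin N) (Fin N) ℂ :=
  diagonal fun i => (I * ω - lam i)⁻¹

lemma continuous_diagResolvent {N : ℕ} {lam : Fin N → ℂ} (hlam : ∀ i, (lam i).re < 0) :
    Continuous (diagResolvent lam) :=
  Continuous.matrix_diagonal (continuous_pi fun i => continuous_inv_I_mul_sub (hlam i))

/-- The integral form exposes the positivity of `𝒞` and its relation to the Gramian, both hidden in
the closed formula. -/
lemma cauchyLike_apply_eq_integral {N nd : ℕ} (Z : Matrix (Fin N) (Fin N) ℂ) {lam : Fin N → ℂ}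
    (hlam : ∀ i, (lam i).re < 0) (Bd : Matrix (Fin N) (Fin nd) ℝ) (b : ℝ) (i j : Fin N) :
    cauchyLike Z lam Bd b i j = 1 / (2 * (Real.pi : ℂ)) * ∫ ω in (-b)..b,
      (diagResolvent lam ω * (Z⁻¹ * (toC Bd * (toC Bd)ᴴ) * (Z⁻¹)ᴴ) * (diagResolvent lam ω)ᴴ) i j := by
  set K := Z⁻¹ * (toC Bd * (toC Bd)ᴴ) * (Z⁻¹)ᴴ with hK
  have : ∀ ω : ℝ, (diagResolvent lam ω * K * (diagResolvent lam ω)ᴴ) i j =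
      K i j * ((I * (ω : ℂ) - lam i)⁻¹ * star (I * (ω : ℂ) - lam j)⁻¹) := fun ω => by
    rw [diagResolvent, diagonal_conjTranspose, mul_diagonal, diagonal_mul, Pi.star_apply]
    ring
  simp only [this]
  rw [intervalIntegral.integral_const_mul, mul_left_comm,
    integral_inv_mul_star_inv (hlam i) (hlam j), cauchyLike, of_apply, ← hK]
  ring

lemma posSemidef_cauchyLike {N nd : ℕ} (Z : Matrix (Fin N) (Fin N) ℂ) {lam : Fin N → ℂ}
    (hlam : ∀ i, (lam i).re < 0) (Bd : Matrix (Fin N) (Fin nd) ℝ) {b : ℝ} (hb : 0 ≤ b) :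
    (cauchyLike Z lam Bd b).PosSemidef := by
  have hD := continuous_diagResolvent hlam
  have h := posSemidef_integral
    (F := fun ω => diagResolvent lam ω * (Z⁻¹ * (toC Bd * (toC Bd)ᴴ) * (Z⁻¹)ᴴ) *
      (diagResolvent lam ω)ᴴ) (by fun_prop) (fun ω =>
      (((posSemidef_self_mul_conjTranspose (toC Bd)).mul_mul_conjTranspose_same
        Z⁻¹).mul_mul_conjTranspose_same (diagResolvent lam ω))) (neg_le_self hb)
  have h2 := h.smul (α := ℝ) (a := (2 * Real.pi)⁻¹) (by positivity)
  convert h2 using 1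
  ext i j
  rw [cauchyLike_apply_eq_integral Z hlam]
  simp

lemma cauchyLike_apply_self {N nd : ℕ} (Z : Matrix (Fin N) (Fin N) ℂ) {lam : Fin N → ℂ}
    (hlam : ∀ i, (lam i).re < 0) (Bd : Matrix (Fin N) (Fin nd) ℝ) (b : ℝ) (i : Fin N) :
    cauchyLike Z lam Bd b i i = ((∑ j, ‖(Z⁻¹ * toC Bd) i j‖ ^ 2) *
      -(thetaC b (lam i) / (2 * Real.pi * (lam i).re)) : ℝ) := by
  have hK : Z⁻¹ * (toC Bd * (toC Bd)ᴴ) * (Z⁻¹)ᴴ = (Z⁻¹ * toC Bd) * (Z⁻¹ * toC Bd)ᴴ := by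
    rw [conjTranspose_mul]; simp only [Matrix.mul_assoc]
  rw [cauchyLike, of_apply, hK, mul_conjTranspose_apply_self, ← two_pi_mul_cauchyCoeff_re b (lam i)]
  have h1 : lam i + star (lam i) = ((2 * (lam i).re : ℝ) : ℂ) := add_conj _
  have h2 : cauchyCoeff b (lam i) + star (cauchyCoeff b (lam i)) =
    ((2 * (cauchyCoeff b (lam i)).re : ℝ) : ℂ) := add_conj _
  rw [h1, h2]
  have := (hlam i).ne
  have := Real.pi_ne_zero
  norm_cast
  field_simp

/-- An entry is no larger than its column, the image under `W` of a unit vector; a row has `nd`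
entries. -/
lemma sum_norm_sq_row_le {N nd : ℕ} (W : Matrix (Fin N) (Fin N) ℂ) {Bd : Matrix (Fin N) (Fin nd) ℝ}
    (hBd : ∀ j, ∑ i, Bd i j ^ 2 = 1) (i : Fin N) :
    ∑ j, ‖(W * toC Bd) i j‖ ^ 2 ≤ specNorm W ^ 2 * nd := by
  have : ∀ j, ‖(W * toC Bd) i j‖ ^ 2 ≤ specNorm W ^ 2 := fun j => by
    have h := sum_norm_sq_mulVec_le W fun k => toC Bd k j
    have h1 : ∑ k, ‖toC Bd k j‖ ^ 2 = 1 := by simpa using hBd j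
    rw [h1, mul_one] at h
    exact (Finset.single_le_sum (f := fun k => ‖(W *ᵥ fun k => toC Bd k j) k‖ ^ 2)
      (fun k _ => sq_nonneg _) (Finset.mem_univ i)).trans h
  refine (Finset.sum_le_sum fun j _ => this j).trans ?_
  simp [mul_comm]

/-- The Gramian in the coordinates of the eigenvectors of the closed-loop matrix. -/
lemma gramian_eq {N nd : ℕ} {A G X : Matrix (Fin N) (Fin N) ℝ} (hG : Gᵀ = G) (hX : Xᵀ = X)
    {Z : Matrix (Fin N) (Fin N) ℂ} {lam : Fin N → ℂ} (hZ : IsUnit Z)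
    (hlam : ∀ i, (lam i).re < 0) (hdiag : toC (A - G * X) * Z = Z * diagonal lam)
    (Bd : Matrix (Fin N) (Fin nd) ℝ) (b : ℝ) :
    gramian A G X Bd b = Z * cauchyLike Z lam Bd b * Zᴴ := by
  have hdet := (isUnit_iff_isUnit_det Z).mp hZ
  have hcl : toC A - toC G * toC X = toC (A - G * X) := by
    rw [← toC_mul]; ext; simp
  have hinv : ∀ ω : ℝ, ((I * (ω : ℂ)) • (1 : Matrix (Fin N) (Fin N) ℂ) - toC A +
      toC G * toC X)⁻¹ = Z * diagResolvent lam ω * Z⁻¹ := fun ω => by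
    refine inv_eq_right_inv ?_
    rw [sub_add, hcl]
    have h1 : ((I * (ω : ℂ)) • (1 : Matrix (Fin N) (Fin N) ℂ) - toC (A - G * X)) * Z =
        Z * diagonal fun i => I * (ω : ℂ) - lam i := by
      rw [Matrix.sub_mul, hdiag, ← diagonal_sub (fun _ => I * (ω : ℂ)) lam, Matrix.mul_sub]
      congr 1
      rw [smul_mul, Matrix.one_mul]
      ext i j
      simp [mul_comm]
    rw [← Matrix.mul_assoc, ← Matrix.mul_assoc, h1, Matrix.mul_assoc Z, diagResolvent,
      diagonal_mul_diagonal]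
    have : (fun i => (I * (ω : ℂ) - lam i) * (I * (ω : ℂ) - lam i)⁻¹) = fun _ => 1 := by
      ext i
      exact mul_inv_cancel₀ (I_mul_sub_ne_zero (hlam i) ω)
    rw [this, diagonal_one, Matrix.mul_one, mul_nonsing_inv _ hdet]
  have hcT : ∀ U : Matrix (Fin N) (Fin N) ℝ, (toC U)ᴴ = toC Uᵀ := fun U => by ext; simp
  -- The right-hand resolvent is the adjoint of the left-hand one, because `A`, `G`, `X` are real
  -- and `G`, `X` symmetric.
  have hinv' : ∀ ω : ℝ, ((-(I * (ω : ℂ))) • (1 : Matrix (Fin N) (Fin N) ℂ) - (toC A)ᵀ +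
      toC X * toC G)⁻¹ = (Z⁻¹)ᴴ * (diagResolvent lam ω)ᴴ * Zᴴ := fun ω => by
    have h1 : (-(I * (ω : ℂ))) • (1 : Matrix (Fin N) (Fin N) ℂ) - (toC A)ᵀ + toC X * toC G =
        ((I * (ω : ℂ)) • (1 : Matrix (Fin N) (Fin N) ℂ) - toC A + toC G * toC X)ᴴ := by
      rw [conjTranspose_add, conjTranspose_sub, conjTranspose_mul, hcT, hcT, hcT, hX, hG]
      simp [transpose_map]
    rw [h1, ← conjTranspose_nonsing_inv, hinv ω, conjTranspose_mul, conjTranspose_mul,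
      Matrix.mul_assoc]
  have hBH : (toC Bd)ᵀ = (toC Bd)ᴴ := by ext; simp
  have hD := continuous_diagResolvent hlam
  have hCt : Continuous fun ω => diagResolvent lam ω *
      (Z⁻¹ * (toC Bd * (toC Bd)ᴴ) * (Z⁻¹)ᴴ) * (diagResolvent lam ω)ᴴ := by fun_prop
  ext i j
  have hF : ∀ ω : ℝ, (Z * diagResolvent lam ω * Z⁻¹ * (toC Bd * (toC Bd)ᴴ) *
      ((Z⁻¹)ᴴ * (diagResolvent lam ω)ᴴ * Zᴴ)) i j = ∑ l, (∑ k, Z i k * (diagResolvent lam ω *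
      (Z⁻¹ * (toC Bd * (toC Bd)ᴴ) * (Z⁻¹)ᴴ) * (diagResolvent lam ω)ᴴ) k l) * Zᴴ l j := fun ω => by
    simp only [← mul_apply]
    simp only [Matrix.mul_assoc]
  simp only [gramian, of_apply, hinv, hinv', hBH, hF]
  rw [intervalIntegral.integral_finsetSum fun l _ =>
    Continuous.intervalIntegrable (by fun_prop) _ _, Finset.mul_sum, mul_apply]
  refine Finset.sum_congr rfl fun l _ => ?_
  rw [intervalIntegral.integral_mul_const, intervalIntegral.integral_finsetSum fun k _ =>
    Continuous.intervalIntegrable (by fun_prop) _ _, ← mul_assoc, Finset.mul_sum, mul_apply]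
  congr 1
  refine Finset.sum_congr rfl fun k _ => ?_
  rw [intervalIntegral.integral_const_mul, cauchyLike_apply_eq_integral Z hlam]
  ring

lemma posSemidef_lowRankGramian {N nd : ℕ} (Z : Matrix (Fin N) (Fin N) ℂ) {lam : Fin N → ℂ}
    (hlam : ∀ i, (lam i).re < 0) (Bd : Matrix (Fin N) (Fin nd) ℝ) {b : ℝ} (hb : 0 ≤ b)
    (κ : ℕ) (hκ : κ ≤ N) : (lowRankGramian Z lam Bd b κ hκ).PosSemidef :=
  ((posSemidef_cauchyLike Z hlam Bd hb).submatrix _).mul_mul_conjTranspose_same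
    (Z.submatrix id (Fin.castLE hκ))

/-- The rows of `T` with index below `κ`, the others being replaced by `0`. -/
def truncateRows {N p : ℕ} (κ : ℕ) (T : Matrix (Fin N) (Fin p) ℂ) : Matrix (Fin N) (Fin p) ℂ :=
  Matrix.of fun i j => if i.val < κ then T i j else 0

/-- Zero padding replaces index restriction, so that a factor and its truncation have the same size
and can be subtracted. -/
lemma submatrix_castLE_mul {N κ : ℕ} {m p : Type*} (hκ : κ ≤ N) (U : Matrix m (Fin N) ℂ)
    (V : Matrix (Fin N) p ℂ) :
    U.submatrix id (Fin.castLE hκ) * V.submatrix (Fin.castLE hκ) id =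
      U * Matrix.of fun i j => if i.val < κ then V i j else 0 := by
  ext i j
  simp only [mul_apply, submatrix_apply, id, of_apply, mul_ite, mul_zero]
  rw [← Finset.sum_filter]
  refine Finset.sum_bij (fun k _ => Fin.castLE hκ k) (by simp) (fun a _ b _ h => by
    simpa using h) (fun k hk => ⟨⟨k, by simpa using hk⟩, by simp, rfl⟩) (fun _ _ => rfl)

lemma lowRankGramian_eq {N nd p : ℕ} {Z : Matrix (Fin N) (Fin N) ℂ} {lam : Fin N → ℂ}
    {Bd : Matrix (Fin N) (Fin nd) ℝ} {b : ℝ} {κ : ℕ} (hκ : κ ≤ N) {T : Matrix (Fin N) (Fin p) ℂ}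
    (hT : T * Tᴴ = cauchyLike Z lam Bd b) :
    lowRankGramian Z lam Bd b κ hκ = (Z * truncateRows κ T) * (Z * truncateRows κ T)ᴴ := by
  rw [truncateRows, ← submatrix_castLE_mul hκ, conjTranspose_mul, lowRankGramian, ← hT]
  simp only [conjTranspose_submatrix, Matrix.mul_assoc]
  congr 1
  rw [← Matrix.mul_assoc]
  rfl

lemma frobNorm_sub_truncateRows_sq {N p : ℕ} (κ : ℕ) (T : Matrix (Fin N) (Fin p) ℂ) :
    frobNorm (T - truncateRows κ T) ^ 2 = ∑ i : Fin N with κ ≤ i.val, ∑ j, ‖T i j‖ ^ 2 := by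
  rw [frobNorm_sq, Finset.sum_filter]
  refine Finset.sum_congr rfl fun i _ => ?_
  by_cases h : i.val < κ
  · simp [truncateRows, h, not_le.mpr h]
  · simp [truncateRows, h, not_lt.mp h]

open scoped MatrixOrder in
lemma exists_mul_conjTranspose_eq {N : ℕ} {C : Matrix (Fin N) (Fin N) ℂ}
    (hC : C.PosSemidef) : ∃ T : Matrix (Fin N) (Fin N) ℂ, T * Tᴴ = C := by
  obtain ⟨T, hT, -, h⟩ := CFC.exists_sqrt_of_isSelfAdjoint_of_quasispectrumRestricts
    hC.isHermitian (QuasispectrumRestricts.nnreal_of_nonneg hC.nonneg)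
  exact ⟨T, by rw [← star_eq_conjTranspose, hT.star_eq]; exact h⟩

end WAC

theorem theorem2
    -- the power system model, its disturbance input, and the frequency range
    {n nd : ℕ} (S : WAC.PowerSystem n)
    (hS : WAC.IsConsensusStable S.stateMatrix)
    (Bd : Matrix (Fin (4 * n)) (Fin nd) ℝ) (hBd : ∀ j, ∑ i, Bd i j ^ 2 = 1)
    (ωbar : ℝ) (hω : 0 < ωbar)
    -- the design matrices, and the left null vector that defines the shifted matrix
    (Q : Matrix (Fin (4 * n)) (Fin (4 * n)) ℝ) (hQ : Q.PosSemidef)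
    (hQker : ∀ x : Fin (4 * n) → ℝ, Q.mulVec x = 0 ↔ ∃ t : ℝ, x = t • S.v0)
    (R : Matrix (Fin n) (Fin n) ℝ) (hR : R.PosDef)
    (w₀ : Fin (4 * n) → ℝ) (hw₀ : Matrix.vecMul w₀ S.stateMatrix = 0) (hw₀v : w₀ ⬝ᵥ S.v0 = 1)
    (ε : ℝ) (hε : 0 < ε)
    (Aε : Matrix (Fin (4 * n)) (Fin (4 * n)) ℝ)
    (hAε : Aε = WAC.shifted S.stateMatrix S.v0 w₀ ε)
    (G : Matrix (Fin (4 * n)) (Fin (4 * n)) ℝ) (hG : G = WAC.gainMatrix S.inputMatrix R)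
    (X : Matrix (Fin (4 * n)) (Fin (4 * n)) ℝ) (hX : WAC.IsStabilizingSolution Aε G Q X)
    -- the stable eigenvalues and eigenvectors of the Hamiltonian matrix, in any order
    (Z Zb : Matrix (Fin (4 * n)) (Fin (4 * n)) ℂ) (lam : Fin (4 * n) → ℂ)
    (hZ : WAC.IsStableEigenbasis (WAC.hamiltonian Aε G Q) Z Zb lam)
    (κ : ℕ) (hκ : κ ≤ 4 * n)
    -- the number of clusters and the clustering weight
    (r : ℕ) (w : Fin n → ℝ) :
    -- the two Gramians have square roots
    (WAC.gramian Aε G X Bd ωbar).PosSemidef ∧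
    (WAC.lowRankGramian Z lam Bd ωbar κ hκ).PosSemidef ∧
    -- the error bound, for all square roots and every minimizer
    ∀ (p q : ℕ) (Φh : Matrix (Fin (4 * n)) (Fin p) ℂ) (Φκh : Matrix (Fin (4 * n)) (Fin q) ℂ),
      Φh * Φhᴴ = WAC.gramian Aε G X Bd ωbar →
      Φκh * Φκhᴴ = WAC.lowRankGramian Z lam Bd ωbar κ hκ →
      ∀ c ∈ WAC.admissible r w,
        (∀ c' ∈ WAC.admissible r w, WAC.objective w Φκh c ≤ WAC.objective w Φκh c') →
        WAC.objective w Φh c - WAC.objective w Φκh c ≤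
          √(WAC.condNumber Z⁻¹ ^ 2 * nd *
            ∑ i : Fin (4 * n) with κ ≤ i.val,
              -(WAC.thetaC ωbar (lam i) / (2 * Real.pi * (lam i).re))) := by
  have hGt : Gᵀ = G := hG ▸ WAC.transpose_gainMatrix _ hR.1
  have hXt : Xᵀ = X := hX.posSemidef.1
  obtain ⟨hZu, hdiag⟩ := hZ.diagonalizes hX hGt
  have hlam := hZ.stable
  have hgram := WAC.gramian_eq hGt hXt hZu hlam hdiag Bd ωbar
  have hC := WAC.posSemidef_cauchyLike Z hlam Bd hω.le
  refine ⟨hgram ▸ hC.mul_mul_conjTranspose_same Z,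
    WAC.posSemidef_lowRankGramian Z hlam Bd hω.le κ hκ, fun p q Φh Φκh hΦ hΦκ c hc _ => ?_⟩
  obtain ⟨T, hT⟩ := WAC.exists_mul_conjTranspose_eq hC
  simp only [WAC.objective]
  set E := 1 - WAC.toC ((WAC.stackedProj w c)ᵀ * WAC.stackedProj w c)
  have hE1 : WAC.specNorm E ≤ 1 := WAC.specNorm_complement_le_one hc
  set T' := WAC.truncateRows κ T
  have hinvar : ∀ {p q : ℕ} {U : Matrix (Fin (4 * n)) (Fin p) ℂ}
      {V : Matrix (Fin (4 * n)) (Fin q) ℂ}, U * Uᴴ = V * Vᴴ →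
      WAC.frobNorm (E * U) = WAC.frobNorm (E * V) := fun {p q U V} h => by
    refine WAC.frobNorm_eq_of_mul_conjTranspose_eq ?_
    rw [Matrix.conjTranspose_mul, Matrix.conjTranspose_mul, Matrix.mul_assoc, Matrix.mul_assoc,
      ← Matrix.mul_assoc U, ← Matrix.mul_assoc V, h]
  have h1 : WAC.frobNorm (E * Φh) = WAC.frobNorm (E * (Z * T)) := hinvar <| by
    rw [hΦ, hgram, ← hT, Matrix.conjTranspose_mul]
    simp only [Matrix.mul_assoc]
  have h2 : WAC.frobNorm (E * Φκh) = WAC.frobNorm (E * (Z * T')) :=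
    hinvar (hΦκ.trans (WAC.lowRankGramian_eq hκ hT))
  have h3 : WAC.frobNorm (E * (Z * T)) - WAC.frobNorm (E * (Z * T')) ≤
      WAC.frobNorm (E * (Z * (T - T'))) := by
    have := WAC.frobNorm_add_le (E * (Z * T')) (E * (Z * (T - T')))
    rw [← Matrix.mul_add, ← Matrix.mul_add, add_sub_cancel] at this
    linarith
  have h4 : WAC.frobNorm (E * (Z * (T - T'))) ≤ WAC.specNorm Z * WAC.frobNorm (T - T') :=
    calc _ ≤ WAC.specNorm E * WAC.frobNorm (Z * (T - T')) := WAC.frobNorm_mul_le _ _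
      _ ≤ 1 * WAC.frobNorm (Z * (T - T')) :=
        mul_le_mul_of_nonneg_right hE1 (WAC.frobNorm_nonneg _)
      _ ≤ _ := by rw [one_mul]; exact WAC.frobNorm_mul_le _ _
  have h5 : WAC.frobNorm (T - T') ^ 2 ≤ WAC.specNorm Z⁻¹ ^ 2 * nd *
      ∑ i : Fin (4 * n) with κ ≤ i.val,
        -(WAC.thetaC ωbar (lam i) / (2 * Real.pi * (lam i).re)) := by
    rw [WAC.frobNorm_sub_truncateRows_sq, Finset.mul_sum]
    refine Finset.sum_le_sum fun i _ => ?_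
    -- The squared norm of row `i` of `T` is the diagonal entry `𝒞 i i`, known in closed form.
    have hTi := WAC.mul_conjTranspose_apply_self T i
    rw [hT, WAC.cauchyLike_apply_self Z hlam, Complex.ofReal_inj] at hTi
    rw [← hTi]
    refine mul_le_mul_of_nonneg_right (WAC.sum_norm_sq_row_le Z⁻¹ hBd i) ?_
    rw [neg_nonneg]
    exact div_nonpos_of_nonneg_of_nonpos (WAC.thetaC_nonneg hω.le (hlam i))
      (mul_nonpos_of_nonneg_of_nonpos (by positivity) (hlam i).le)
  rw [h1, h2]
  refine (h3.trans h4).trans (Real.le_sqrt_of_sq_le ?_)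
  -- The inverse of `Z⁻¹` is `Z`, so the condition number supplies both `‖Z⁻¹‖` and `‖Z‖`.
  rw [mul_pow, WAC.condNumber, Matrix.nonsing_inv_nonsing_inv _
    ((Matrix.isUnit_iff_isUnit_det Z).mp hZu), mul_pow]
  nlinarith [mul_le_mul_of_nonneg_left h5 (sq_nonneg (WAC.specNorm Z))]
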